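/- For $n\ge 1$ let $S=\{x\in\mathbb R^{n+1} : \sum_{j=1}^{n+1}x_j=1,\ x_j\ge 0 \text{ for all } j\}$ be the embedded regular $n$-simplex, for $a\in\mathbb R^{n+1}\setminus\{0\}$ let $H_a=\{x\in\mathbb R^{n+1} : \langle a,x\rangle=0\}$, let $\mathrm{vol}_{n-1}$ denote $(n-1)$-dimensional Euclidean volume (the Lebesgue measure induced on $(n-1)$-dimensional affine subspaces), and let $$a_{\min}=\left(\sqrt{\tfrac{n}{n+1}},\,-\tfrac{1}{\sqrt{n(n+1)}},\dots,-\tfrac{1}{\sqrt{n(n+1)}}\right)\in\mathbb R^{n+1},$$ which is a unit vector with coordinate sum zero. (i) For every $n\ge1$ and every $a\in\mathbb R^{n+1}$ with $\|a\|=1$, $\sum_{j=1}^{n+1}a_j=0$ and $a_1\ge 0\ge a_2,\dots,a_{n+1}$, $$\mathrm{vol}_{n-1}(H_a\cap S)\ \ge\ \mathrm{vol}_{n-1}(H_{a_{\min}}\cap S).$$ In particular, $a_{\min}$ is a local minimum of $a\mapsto \mathrm{vol}_{n-1}(H_a\cap S)$ on the set of all $a\in\mathbb R^{n+1}$ with $\|a\|=1$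 and $\sum_{j=1}^{n+1} a_j=0$. (ii) For $n=2,3,4$ the section by $H_{a_{\min}}$ is globally minimal: for every $a\in\mathbb R^{n+1}$ with $\|a\|=1$ and $\sum_{j=1}^{n+1}a_j=0$, $$\mathrm{vol}_{n-1}(H_a\cap S)\ \ge\ \mathrm{vol}_{n-1}(H_{a_{\min}}\cap S).$$ -/

import Mathlib

open scoped RealInnerProductSpace

noncomputable section

/-- The embedded regular `n`-simplex `S` in `ℝ^{n+1}`. -/
def regSimplex (n : ℕ) : Set (EuclideanSpace ℝ (Fin (n + 1))) :=
  {x | ∑ j, x j = 1 ∧ ∀ j, 0 ≤ x j}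

/-- The linear hyperplane `H_a = {x | ⟨a, x⟩ = 0}`. -/
def centralHyperplane {n : ℕ} (a : EuclideanSpace ℝ (Fin (n + 1))) :
    Set (EuclideanSpace ℝ (Fin (n + 1))) :=
  {x | ⟪a, x⟫ = 0}

/-- The `k`-dimensional volume of a subset of Euclidean space: `k`-dimensional Hausdorff measure,
normalized so that on every `k`-dimensional affine subspace it is the induced Lebesgue measure. -/
def kVol {n : ℕ} (k : ℕ) (A : Set (EuclideanSpace ℝ (Fin (n + 1)))) : ENNReal :=
  MeasureTheory.Measure.euclideanHausdorffMeasure k A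

/-- `vol_{n-1}(H_a ∩ S)`. -/
def sectionVol {n : ℕ} (a : EuclideanSpace ℝ (Fin (n + 1))) : ENNReal :=
  kVol (n - 1) (centralHyperplane a ∩ regSimplex n)

/-- Unit normals with coordinate sum zero: `H_a` then passes through the centroid of `S`. -/
def centralNormals (n : ℕ) : Set (EuclideanSpace ℝ (Fin (n + 1))) :=
  {a | ‖a‖ = 1 ∧ ∑ j, a j = 0}

/-- The normal vector `a_min = (√(n/(n+1)), -1/√(n(n+1)), …, -1/√(n(n+1)))`. -/
def aMin (n : ℕ) : EuclideanSpace ℝ (Fin (n + 1)) :=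
  WithLp.toLp 2 fun j =>
    if j = 0 then Real.sqrt ((n : ℝ) / ((n : ℝ) + 1))
    else -(1 / Real.sqrt ((n : ℝ) * ((n : ℝ) + 1)))

end

open MeasureTheory Filter Topology

/-! Projecting the plane `∑ x = 1`, `⟨a, x⟩ = 0` to all but two coordinates multiplies volume by a
constant factor, so sections become explicit polytopes (`kVol_centralPlane_over`). The Gram factor
depends only on the dimension when `a` is a unit vector with sum zero, so it drops out of every
comparison.

If `a 0` is the only positive entry, the section is a simplex of normalized volume `a 0 ^ m / ∏ (a 0
- a k)` (`sectionVol_of_one_pos`). The factors `a 0 - a k` have mean `a 0 / minHead m ^ 2`, so AM-GM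
bounds the product, and Cauchy-Schwarz gives `a 0 ≤ minHead m`. Together these give (i), and the
local minimum follows because the negative entries of `aMin` stay negative nearby.

Since `H_a = H_{-a}`, only the sign patterns 2+2 (`n = 3`) and 2+3 (`n = 4`) remain for (ii). With
positive entries `p > q`, the section contains the simplex at `p` minus the simplex at `q`, whose
volume is a divided difference (`sectionVol_ge_of_two_pos_lt`). The case `p = q` comes from a
one-sided limit. After cancelling `p - q`, rational inequalities remain (`two_two_bound`,
`two_three_bound`), proved in elementary symmetric functions. -/

/-! ### Volume on the plane through a coordinate projection. -/

/-- The plane `{x | ∑ x = 1, ⟨a, x⟩ = 0}`. -/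
def centralPlane {m : ℕ} (a : Fin m → ℝ) : Set (EuclideanSpace ℝ (Fin m)) :=
  {x | ∑ j, x j = 1 ∧ ∑ j, a j * x j = 0}

/-- The Gram determinant of the all-ones vector and `a`. -/
def onesGram {m : ℕ} (a : Fin m → ℝ) : ℝ := m * ∑ j, a j ^ 2 - (∑ j, a j) ^ 2

/-- The linear map recovering a direction with `x 0 = ∑ α y`, `x 1 = ∑ β y` from its remaining
coordinates `y`. -/
def graphMap {m : ℕ} (α β : Fin m → ℝ) :
    EuclideanSpace ℝ (Fin m) →ₗ[ℝ] EuclideanSpace ℝ (Fin (m + 2)) where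
  toFun y := WithLp.toLp 2 (Fin.cons (∑ k, α k * y k) (Fin.cons (∑ k, β k * y k) y.ofLp))
  map_add' x y := by
    ext i
    refine Fin.cases ?_ (fun i => Fin.cases ?_ (fun i => ?_) i) i <;>
      simp [mul_add, Finset.sum_add_distrib]
  map_smul' c y := by
    ext i
    refine Fin.cases ?_ (fun i => Fin.cases ?_ (fun i => ?_) i) i <;>
      simp [Finset.mul_sum, mul_left_comm]

/-- The Gram matrix is the identity plus a rank-two term `W * Wᵀ`, so `det (1 + W * Wᵀ) = det (1 +
Wᵀ * W)` leaves a 2×2 determinant. -/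
theorem normDet_graphMap_sq {m : ℕ} (α β : Fin m → ℝ) :
    (graphMap α β).normDet ^ 2 =
      (1 + ∑ k, α k ^ 2) * (1 + ∑ k, β k ^ 2) - (∑ k, α k * β k) ^ 2 := by
  have h := (graphMap α β).normDet_sq_eq_det_gram (EuclideanSpace.basisFun (Fin m) ℝ)
  simp only [RCLike.ofReal_real_eq_id, id] at h
  rw [h]
  let W : Matrix (Fin m) (Fin 2) ℝ := Matrix.of fun k => ![α k, β k]
  have hG : Matrix.gram ℝ (fun x => graphMap α β (EuclideanSpace.basisFun (Fin m) ℝ x)) =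
      1 + W * W.transpose := by
    ext i j
    simp [Matrix.gram_apply, graphMap, PiLp.inner_apply, Fin.sum_univ_succ, Matrix.mul_apply, W,
      Matrix.one_apply, Pi.single_apply]
    ring
  rw [hG, Matrix.det_one_add_mul_comm, Matrix.det_fin_two]
  simp [Matrix.mul_apply, W, pow_two, mul_comm]

/-- The determinant is `m` times the sum of squared deviations from the mean, which vanishes only
for constant vectors. -/
theorem onesGram_pos {m : ℕ} {a : Fin m → ℝ} {i j : Fin m} (h : a i ≠ a j) : 0 < onesGram a := by
  have hm : (0 : ℝ) < m := by exact_mod_cast i.pos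
  set μ := (∑ k, a k) / m with hμ
  have hs : ∑ k, a k = m * μ := by rw [hμ]; field_simp
  have key : onesGram a = m * ∑ k, (a k - μ) ^ 2 := by
    simp only [onesGram, sub_sq, Finset.sum_add_distrib, Finset.sum_sub_distrib, ← Finset.mul_sum,
      ← Finset.sum_mul, hs]
    simp
    ring
  rw [key]
  refine mul_pos hm (lt_of_le_of_ne (Finset.sum_nonneg fun _ _ => sq_nonneg _) fun h0 => h ?_)
  have := (Finset.sum_eq_zero_iff_of_nonneg fun k _ => sq_nonneg (a k - μ)).1 h0.symm
  have h1 := pow_eq_zero_iff (two_ne_zero) |>.1 (this i (Finset.mem_univ _))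
  have h2 := pow_eq_zero_iff (two_ne_zero) |>.1 (this j (Finset.mem_univ _))
  linarith

/-- The part of a plane lying over a set of its last coordinates. -/
theorem kVol_centralPlane_over {m : ℕ} (a : Fin (m + 2) → ℝ) (h : a 0 ≠ a 1)
    (E : Set (Fin m → ℝ)) :
    kVol m {x | x ∈ centralPlane a ∧ (fun k : Fin m => x k.succ.succ) ∈ E} =
      ENNReal.ofReal (√(onesGram a) / |a 0 - a 1|) * volume E := by
  set d := a 0 - a 1 with hd
  have hd0 : d ≠ 0 := sub_ne_zero.2 h
  set α : Fin m → ℝ := fun k => (a 1 - a k.succ.succ) / d with hα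
  set β : Fin m → ℝ := fun k => (a k.succ.succ - a 0) / d with hβ
  -- The point of the plane whose remaining coordinates all vanish.
  let v : EuclideanSpace ℝ (Fin (m + 2)) :=
    WithLp.toLp 2 (Fin.cons (-a 1 / d) (Fin.cons (a 0 / d) 0))
  have hset : {x | x ∈ centralPlane a ∧ (fun k : Fin m => x k.succ.succ) ∈ E} =
      (fun x => v + x) '' (graphMap α β '' (WithLp.ofLp ⁻¹' E)) := by
    ext x
    simp only [Set.mem_ofPred_eq, Set.image_image, Set.mem_image, Set.mem_preimage, centralPlane]
    constructor
    · rintro ⟨⟨h1, h2⟩, hE⟩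
      refine ⟨WithLp.toLp 2 fun k => x k.succ.succ, hE, ?_⟩
      rw [Fin.sum_univ_succ, Fin.sum_univ_succ] at h1 h2
      simp only [Fin.succ_zero_eq_one] at h1 h2
      have e1 : ∑ k : Fin m, α k * x k.succ.succ =
          (a 1 * ∑ k : Fin m, x k.succ.succ - ∑ k : Fin m, a k.succ.succ * x k.succ.succ) / d := by
        rw [Finset.mul_sum, ← Finset.sum_sub_distrib, Finset.sum_div]
        exact Finset.sum_congr rfl fun k _ => by simp only [hα]; ring
      have e2 : ∑ k : Fin m, β k * x k.succ.succ =
          (∑ k : Fin m, a k.succ.succ * x k.succ.succ - a 0 * ∑ k : Fin m, x k.succ.succ) / d := by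
        rw [Finset.mul_sum, ← Finset.sum_sub_distrib, Finset.sum_div]
        exact Finset.sum_congr rfl fun k _ => by simp only [hβ]; ring
      ext i
      refine Fin.cases ?_ (fun i => Fin.cases ?_ (fun i => ?_) i) i
      · simp [v, graphMap, e1]
        field_simp
        linear_combination a 1 * h1 - h2 + x 0 * hd
      · simp [v, graphMap, e2]
        field_simp
        linear_combination -a 0 * h1 + h2 + x 1 * hd
      · simp [v, graphMap]
    · rintro ⟨y, hy, rfl⟩
      have e0 : (∑ k, α k * y k) + (∑ k, β k * y k) + ∑ k, y k = 0 := by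
        rw [← Finset.sum_add_distrib, ← Finset.sum_add_distrib]
        refine Finset.sum_eq_zero fun k _ => ?_
        simp only [hα, hβ]
        field_simp
        rw [hd]; ring
      have e3 : a 0 * (∑ k, α k * y k) + a 1 * (∑ k, β k * y k) +
          ∑ k : Fin m, a k.succ.succ * y k = 0 := by
        rw [Finset.mul_sum, Finset.mul_sum, ← Finset.sum_add_distrib, ← Finset.sum_add_distrib]
        refine Finset.sum_eq_zero fun k _ => ?_
        simp only [hα, hβ]
        field_simp
        rw [hd]; ring
      refine ⟨⟨?_, ?_⟩, ?_⟩
      · rw [Fin.sum_univ_succ, Fin.sum_univ_succ]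
        simp [v, graphMap]
        have : -a 1 / d + a 0 / d = 1 := by field_simp; rw [hd]; ring
        linear_combination e0 + this
      · rw [Fin.sum_univ_succ, Fin.sum_univ_succ]
        simp [v, graphMap]
        linear_combination e3
      · simpa [v, graphMap] using hy
  have hdet : (graphMap α β).normDet = √(onesGram a) / |d| := by
    have hsq : (graphMap α β).normDet ^ 2 = onesGram a / d ^ 2 := by
      rw [normDet_graphMap_sq]
      have e1 : ∑ k, α k ^ 2 = (m * a 1 ^ 2 - 2 * a 1 * (∑ k : Fin m, a k.succ.succ) +
          ∑ k : Fin m, a k.succ.succ ^ 2) / d ^ 2 := by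
        simp only [hα, div_pow, ← Finset.sum_div, sub_sq, Finset.sum_add_distrib,
          Finset.sum_sub_distrib, ← Finset.mul_sum]
        simp
      have e2 : ∑ k, β k ^ 2 = (∑ k : Fin m, a k.succ.succ ^ 2 -
          2 * a 0 * (∑ k : Fin m, a k.succ.succ) + m * a 0 ^ 2) / d ^ 2 := by
        simp only [hβ, div_pow, ← Finset.sum_div, sub_sq, Finset.sum_add_distrib,
          Finset.sum_sub_distrib, ← Finset.mul_sum, ← Finset.sum_mul]
        simp; ring
      have e3 : ∑ k, α k * β k = ((a 0 + a 1) * (∑ k : Fin m, a k.succ.succ) -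
          m * (a 0 * a 1) - ∑ k : Fin m, a k.succ.succ ^ 2) / d ^ 2 := by
        have : ∀ k, α k * β k = ((a 0 + a 1) * a k.succ.succ - a 0 * a 1 -
            a k.succ.succ ^ 2) / d ^ 2 := fun k => by
          simp only [hα, hβ]; ring_nf
        simp only [this, ← Finset.sum_div, Finset.sum_sub_distrib, ← Finset.mul_sum]
        simp
        ring
      rw [e1, e2, e3, onesGram, Fin.sum_univ_succ, Fin.sum_univ_succ, Fin.sum_univ_succ,
        Fin.sum_univ_succ]
      simp only [Fin.succ_zero_eq_one]
      push_cast
      generalize ∑ k : Fin m, a k.succ.succ ^ 2 = Q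
      generalize ∑ k : Fin m, a k.succ.succ = s
      have : a 0 = d + a 1 := by rw [hd]; ring
      rw [this]
      field_simp
      ring
    rw [← Real.sqrt_sq_eq_abs, ← Real.sqrt_div' _ (sq_nonneg d), ← hsq,
      Real.sqrt_sq (graphMap α β).normDet_nonneg]
  have himg := (graphMap α β).euclideanHausdorffMeasure_image_eq_normDet_mul_volume
    (WithLp.ofLp ⁻¹' E)
  rw [finrank_euclideanSpace_fin, hdet] at himg
  rw [kVol, hset, Set.image_add_left, measure_preimage_add, himg]
  congr 1
  exact (PiLp.volume_preserving_ofLp (Fin m)).measure_preimage_equiv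
    (f := (MeasurableEquiv.toLp 2 (Fin m → ℝ)).symm) E

/-! ### Volumes of simplicial cells. -/

/-- The volume of the corner simplex `{y ≥ 0, ∑ y ≤ 1}`. -/
noncomputable def cornerVol (m : ℕ) : ENNReal :=
  volume {y : Fin m → ℝ | (∀ k, 0 ≤ y k) ∧ ∑ k, y k ≤ 1}

theorem cornerVol_ne_top (m : ℕ) : cornerVol m ≠ ⊤ := by
  refine ne_top_of_le_ne_top (b := volume (Set.Icc (0 : Fin m → ℝ) 1)) ?_ (measure_mono ?_)
  · exact isCompact_Icc.measure_lt_top.ne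
  · rintro y ⟨h0, h1⟩
    exact ⟨h0, fun k => (Finset.single_le_sum (fun i _ => h0 i) (Finset.mem_univ k)).trans h1⟩

theorem volume_preimage_diagonal {m : ℕ} (c : Fin m → ℝ) (hc : ∀ k, c k ≠ 0)
    (E : Set (Fin m → ℝ)) :
    volume {y : Fin m → ℝ | (fun k => c k * y k) ∈ E} =
      ENNReal.ofReal (1 / ∏ k, |c k|) * volume E := by
  have hdet : LinearMap.det (Matrix.toLin' (Matrix.diagonal c)) = ∏ k, c k := by
    rw [LinearMap.det_toLin', Matrix.det_diagonal]
  have h0 : LinearMap.det (Matrix.toLin' (Matrix.diagonal c)) ≠ 0 := by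
    rw [hdet]; exact Finset.prod_ne_zero_iff.2 fun k _ => hc k
  have := Measure.addHaar_preimage_linearMap volume h0 E
  rw [hdet, abs_inv, Finset.abs_prod] at this
  rw [one_div, ← this]
  congr 1
  ext y
  have : Matrix.toLin' (Matrix.diagonal c) y = fun k => c k * y k := by
    ext k; simp [Matrix.mulVec_diagonal]
  simp [this]

theorem volume_corner {m : ℕ} (c : Fin m → ℝ) (hc : ∀ k, c k ≠ 0) {s : ℝ} (hs : 0 < s) :
    volume {y : Fin m → ℝ | (∀ k, 0 ≤ c k * y k) ∧ ∑ k, c k * y k ≤ s} =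
      ENNReal.ofReal (s ^ m / ∏ k, |c k|) * cornerVol m := by
  have h := volume_preimage_diagonal (fun k => c k / s) (fun k => div_ne_zero (hc k) hs.ne')
    {y : Fin m → ℝ | (∀ k, 0 ≤ y k) ∧ ∑ k, y k ≤ 1}
  have e : (1 / ∏ k, |c k / s|) = s ^ m / ∏ k, |c k| := by
    simp [abs_div, abs_of_pos hs, Finset.prod_div_distrib]
  rw [e] at h
  rw [cornerVol, ← h]
  congr 1
  ext y
  simp only [Set.mem_ofPred_eq, div_mul_eq_mul_div, ← Finset.sum_div, div_le_one hs,
    le_div_iff₀ hs, zero_mul]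

/-- A simplicial cell of the plane, cut out by sign conditions on all coordinates but `x 0`. -/
def planeCell {m : ℕ} (a : Fin (m + 2) → ℝ) : Set (EuclideanSpace ℝ (Fin (m + 2))) :=
  {x | x ∈ centralPlane a ∧ 0 ≤ x 1 ∧ ∀ k : Fin m, 0 ≤ (a 0 - a k.succ.succ) * x k.succ.succ}

/-- Eliminating `x 0` between the two plane equations turns the sign condition on `x 1` into a
half-space in the remaining coordinates. -/
theorem centralPlane_coord_one {m : ℕ} {a : Fin (m + 2) → ℝ} {x : EuclideanSpace ℝ (Fin (m + 2))}
    (hx : x ∈ centralPlane a) :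
    (a 0 - a 1) * x 1 = a 0 - ∑ k : Fin m, (a 0 - a k.succ.succ) * x k.succ.succ := by
  obtain ⟨h1, h2⟩ := hx
  rw [Fin.sum_univ_succ, Fin.sum_univ_succ] at h1 h2
  simp only [Fin.succ_zero_eq_one] at h1 h2
  simp only [sub_mul, Finset.sum_sub_distrib, ← Finset.mul_sum]
  linear_combination a 0 * h1 - h2

theorem centralPlane_coord_zero {m : ℕ} {a : Fin (m + 2) → ℝ} {x : EuclideanSpace ℝ (Fin (m + 2))}
    (hx : x ∈ centralPlane a) :
    (a 0 - a 1) * x 0 = -a 1 - ∑ k : Fin m, (a k.succ.succ - a 1) * x k.succ.succ := by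
  obtain ⟨h1, h2⟩ := hx
  rw [Fin.sum_univ_succ, Fin.sum_univ_succ] at h1 h2
  simp only [Fin.succ_zero_eq_one] at h1 h2
  simp only [sub_mul, Finset.sum_sub_distrib, ← Finset.mul_sum]
  linear_combination -a 1 * h1 + h2

/-- In the variables `(a 0 - a k) * x k` the projected cell is the corner simplex dilated by `a 0`.
Entries above `a 0` are allowed: they only reverse a sign condition, hence the absolute values. -/
theorem kVol_planeCell {m : ℕ} (a : Fin (m + 2) → ℝ) (h0 : 0 < a 0) (h1 : a 1 < a 0)
    (h : ∀ k : Fin m, a k.succ.succ ≠ a 0) :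
    kVol m (planeCell a) = ENNReal.ofReal (√(onesGram a) *
      (a 0 ^ m / ((a 0 - a 1) * ∏ k : Fin m, |a 0 - a k.succ.succ|))) * cornerVol m := by
  have hset : planeCell a = {x | x ∈ centralPlane a ∧ (fun k : Fin m => x k.succ.succ) ∈
      {y : Fin m → ℝ | (∀ k, 0 ≤ (a 0 - a k.succ.succ) * y k) ∧
        ∑ k, (a 0 - a k.succ.succ) * y k ≤ a 0}} := by
    ext x
    simp only [planeCell, Set.mem_ofPred_eq]
    refine and_congr_right fun hx => ?_
    have hc := centralPlane_coord_one hx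
    rw [and_comm]
    refine and_congr_right fun _ => ?_
    rw [← mul_nonneg_iff_of_pos_left (sub_pos.2 h1), hc, sub_nonneg]
  rw [hset, kVol_centralPlane_over a h1.ne', volume_corner _ (fun k => sub_ne_zero.2 (h k).symm) h0,
    ← mul_assoc, ← ENNReal.ofReal_mul (by positivity), abs_of_pos (sub_pos.2 h1)]
  congr 2
  have : a 0 - a 1 ≠ 0 := (sub_pos.2 h1).ne'
  rw [div_mul_div_comm, mul_div_assoc]

/-! ### Symmetries of the section, and normals with one positive entry. -/

/-- The section of the simplex by the hyperplane orthogonal to `a`. -/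
theorem centralHyperplane_inter_regSimplex {m : ℕ} (a : EuclideanSpace ℝ (Fin (m + 1))) :
    centralHyperplane a ∩ regSimplex m = {x | x ∈ centralPlane a ∧ ∀ j, 0 ≤ x j} := by
  ext x
  simp only [centralHyperplane, regSimplex, centralPlane, Set.mem_inter_iff, Set.mem_ofPred_eq,
    PiLp.inner_apply, RCLike.inner_apply, conj_trivial]
  simp only [mul_comm]
  tauto

theorem kVol_permute {m k : ℕ} (σ : Equiv.Perm (Fin (m + 1)))
    (X : Set (EuclideanSpace ℝ (Fin (m + 1)))) :
    kVol k {x | WithLp.toLp 2 (x ∘ σ) ∈ X} = kVol k X := by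
  let e := LinearIsometryEquiv.piLpCongrLeft 2 ℝ ℝ σ.symm
  have := e.isometry.euclideanHausdorffMeasure_preimage (d := k) X
  rw [e.surjective.range_eq, Set.inter_univ] at this
  exact this

theorem mem_centralPlane_permute {m : ℕ} {a : Fin m → ℝ} (σ : Equiv.Perm (Fin m))
    {x : EuclideanSpace ℝ (Fin m)} :
    WithLp.toLp 2 (x ∘ σ) ∈ centralPlane (a ∘ σ) ↔ x ∈ centralPlane a := by
  simp only [centralPlane, Set.mem_ofPred_eq, Function.comp]
  rw [Equiv.sum_comp σ (fun j => x j), Equiv.sum_comp σ (fun j => a j * x j)]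

theorem onesGram_permute {m : ℕ} (a : Fin m → ℝ) (σ : Equiv.Perm (Fin m)) :
    onesGram (a ∘ σ) = onesGram a := by
  simp only [onesGram, Function.comp]
  rw [Equiv.sum_comp σ (fun j => a j ^ 2), Equiv.sum_comp σ a]

theorem sectionVol_permute {n : ℕ} (a : EuclideanSpace ℝ (Fin (n + 1)))
    (σ : Equiv.Perm (Fin (n + 1))) :
    sectionVol (WithLp.toLp 2 (a ∘ σ)) = sectionVol a := by
  rw [sectionVol, sectionVol, centralHyperplane_inter_regSimplex,
    centralHyperplane_inter_regSimplex, ← kVol_permute σ]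
  congr 1
  ext x
  have h : (∀ j, 0 ≤ x (σ j)) ↔ ∀ j, 0 ≤ x j := σ.forall_congr_left.trans (by simp)
  exact and_congr (mem_centralPlane_permute σ) h

theorem sectionVol_neg {n : ℕ} (a : EuclideanSpace ℝ (Fin (n + 1))) :
    sectionVol (-a) = sectionVol a := by
  simp [sectionVol, centralHyperplane]

theorem sectionVol_of_one_pos {m : ℕ} (a : EuclideanSpace ℝ (Fin (m + 2))) (h0 : 0 < a 0)
    (h : ∀ j, j ≠ 0 → a j ≤ 0) :
    sectionVol a = ENNReal.ofReal (√(onesGram a) *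
      (a 0 ^ m / ∏ k : Fin (m + 1), (a 0 - a k.succ))) * cornerVol m := by
  have h' : ∀ j : Fin (m + 1), a j.succ ≤ 0 := fun j => h _ (Fin.succ_ne_zero j)
  have hset : centralHyperplane a ∩ regSimplex (m + 1) = planeCell a := by
    rw [centralHyperplane_inter_regSimplex]
    ext x
    simp only [planeCell, Set.mem_ofPred_eq]
    refine and_congr_right fun hx => ?_
    have hpos : ∀ k : Fin m, 0 < a 0 - a k.succ.succ := fun k => by linarith [h' k.succ]
    constructor
    · exact fun hj => ⟨hj 1, fun k => mul_nonneg (hpos k).le (hj _)⟩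
    · rintro ⟨hx1, hk⟩
      have hs : ∀ j : Fin (m + 1), 0 ≤ x j.succ :=
        Fin.cases hx1 fun k => (mul_nonneg_iff_of_pos_left (hpos k)).1 (hk k)
      refine Fin.cases ?_ hs
      have h2 := hx.2
      rw [Fin.sum_univ_succ] at h2
      -- The condition `0 ≤ x 0`, absent from the cell, is automatic: `a 0 * x 0` is minus this sum.
      have : ∑ j : Fin (m + 1), a j.succ * x j.succ ≤ 0 :=
        Finset.sum_nonpos fun j _ => mul_nonpos_of_nonpos_of_nonneg (h' j) (hs j)
      exact (mul_nonneg_iff_of_pos_left h0).1 (by linarith)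
  have := kVol_planeCell a h0 ((h' 0).trans_lt h0) fun k => ((h' k.succ).trans_lt h0).ne
  rw [sectionVol, hset]
  refine this.trans ?_
  rw [Fin.prod_univ_succ, Fin.succ_zero_eq_one]
  congr 5
  exact Finset.prod_congr rfl fun k _ => abs_of_pos (by linarith [h' k.succ])

/-! ### Lower bounds for normals with two positive entries. -/

theorem swap_zero_two_one {m : ℕ} : Equiv.swap (0 : Fin (m + 3)) 2 1 = 1 :=
  Equiv.swap_apply_of_ne_of_ne (Fin.succ_ne_zero (0 : Fin (m + 2)))
    fun h => Fin.succ_ne_zero (0 : Fin (m + 1)) (Fin.succ_injective _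
      (show Fin.succ 0 = Fin.succ (Fin.succ 0) from h)).symm

theorem swap_zero_two_succ {m : ℕ} (k : Fin m) :
    Equiv.swap (0 : Fin (m + 3)) 2 k.succ.succ.succ = k.succ.succ.succ :=
  Equiv.swap_apply_of_ne_of_ne (Fin.succ_ne_zero _)
    fun h => Fin.succ_ne_zero k (Fin.succ_injective _ (Fin.succ_injective _
      (show k.succ.succ.succ = Fin.succ (Fin.succ 0) from h)))

/-- A vector with three distinguished leading coordinates. -/
def consThree {m : ℕ} (p b q : ℝ) (t : Fin m → ℝ) : Fin (m + 3) → ℝ :=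
  Fin.cons p (Fin.cons b (Fin.cons q t))

section
variable {m : ℕ} (p b q : ℝ) (t : Fin m → ℝ)
@[simp] theorem consThree_zero : consThree p b q t 0 = p := rfl
@[simp] theorem consThree_one : consThree p b q t 1 = b := rfl
@[simp] theorem consThree_two : consThree p b q t 2 = q := rfl
@[simp] theorem consThree_succ (k : Fin m) : consThree p b q t k.succ.succ.succ = t k := rfl

theorem consThree_swap : consThree p b q t ∘ Equiv.swap 0 2 = consThree q b p t := by
  ext j
  refine Fin.cases ?_ (fun j => Fin.cases ?_ (fun j => Fin.cases ?_ (fun j => ?_) j) j) j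
  · simp
  · change consThree p b q t (Equiv.swap 0 2 1) = _
    rw [swap_zero_two_one]; rfl
  · change consThree p b q t (Equiv.swap 0 2 2) = _
    rw [Equiv.swap_apply_right]; rfl
  · rw [Function.comp_apply, swap_zero_two_succ]
    rfl
end

/-- The normalized volume of a section by a normal with distinct positive entries `p`, `q` and
nonpositive entries `b`, `t`. -/
noncomputable def divDiff {m : ℕ} (p b q : ℝ) (t : Fin m → ℝ) : ℝ :=
  (p ^ (m + 1) / ((p - b) * ∏ k, (p - t k)) - q ^ (m + 1) / ((q - b) * ∏ k, (q - t k))) / (p - q)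

/-- The cell at `p` imposes every sign condition except `0 ≤ x 0`. Its part with `x 0 < 0` lies in
the cell at `q`, where the factor `q - p` reverses that sign. Subadditivity then suffices, with no
need for the overlap to be null. -/
theorem sectionVol_ge_of_two_pos_lt {m : ℕ} {p b q : ℝ} {t : Fin m → ℝ} (hq : 0 < q) (hpq : q < p)
    (hb : b ≤ 0) (ht : ∀ k, t k ≤ 0) :
    ENNReal.ofReal (√(onesGram (consThree p b q t)) * divDiff p b q t) * cornerVol (m + 1) ≤
      sectionVol (n := m + 2) (WithLp.toLp 2 (consThree p b q t)) := by
  have hp : 0 < p := hq.trans hpq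
  have htp : ∀ k, 0 < p - t k := fun k => by linarith [ht k]
  have htq : ∀ k, 0 < q - t k := fun k => by linarith [ht k]
  have hcell₁ := kVol_planeCell (m := m + 1) (consThree p b q t) hp
    (by simp; linarith) (Fin.cases (by change q ≠ p; exact hpq.ne)
      fun k => by simp; linarith [ht k])
  have hcell₂ := kVol_planeCell (m := m + 1) (consThree q b p t) hq
    (by simp; linarith) (Fin.cases (by change p ≠ q; exact hpq.ne')
      fun k => by simp; linarith [ht k])
  rw [← consThree_swap, onesGram_permute, consThree_swap] at hcell₂
  have hsub : planeCell (m := m + 1) (consThree p b q t) ⊆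
      {x | x ∈ centralPlane (consThree p b q t) ∧ ∀ j, 0 ≤ x j} ∪
      {x | WithLp.toLp 2 (x ∘ Equiv.swap 0 2) ∈ planeCell (m := m + 1) (consThree q b p t)} := by
    rintro x ⟨hx, h1, hk⟩
    have hk2 : 0 ≤ x 2 := (mul_nonneg_iff_of_pos_left (sub_pos.2 hpq)).1 (hk 0)
    have hk3 : ∀ k : Fin m, 0 ≤ x k.succ.succ.succ := fun k =>
      (mul_nonneg_iff_of_pos_left (htp k)).1 (hk k.succ)
    by_cases h0 : 0 ≤ x 0
    · exact Or.inl ⟨hx, Fin.cases h0 (Fin.cases h1 (Fin.cases hk2 hk3))⟩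
    · right
      push Not at h0
      refine ⟨?_, ?_, ?_⟩
      · rw [← consThree_swap]
        exact (mem_centralPlane_permute _).2 hx
      · change 0 ≤ x (Equiv.swap 0 2 1)
        rwa [swap_zero_two_one]
      · refine Fin.cases ?_ fun k => ?_
        · change 0 ≤ (q - p) * x (Equiv.swap 0 2 2)
          rw [Equiv.swap_apply_right]
          exact mul_nonneg_of_nonpos_of_nonpos (by linarith) h0.le
        · change 0 ≤ (q - t k) * x (Equiv.swap 0 2 k.succ.succ.succ)
          rw [swap_zero_two_succ]
          exact mul_nonneg (htq k).le (hk3 k)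
  have hle : kVol (m + 1) (planeCell (m := m + 1) (consThree p b q t)) ≤ _ :=
    (measure_mono hsub).trans (measure_union_le _ _)
  have hperm := kVol_permute (m := m + 2) (k := m + 1) (Equiv.swap 0 2)
    (planeCell (m := m + 1) (consThree q b p t))
  have hB : ∏ k : Fin (m + 1), |consThree q b p t 0 - consThree q b p t k.succ.succ| =
      (p - q) * ∏ k, (q - t k) := by
    rw [Fin.prod_univ_succ]
    congr 1
    · change |q - p| = _
      rw [abs_of_neg (by linarith)]; ring
    · exact Finset.prod_congr rfl fun k _ => abs_of_pos (htq k)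
  have hA : ∏ k : Fin (m + 1), |consThree p b q t 0 - consThree p b q t k.succ.succ| =
      (p - q) * ∏ k, (p - t k) := by
    rw [Fin.prod_univ_succ]
    congr 1
    · change |p - q| = _
      rw [abs_of_pos (by linarith)]
    · exact Finset.prod_congr rfl fun k _ => abs_of_pos (htp k)
  rw [hA, consThree_zero, consThree_one] at hcell₁
  rw [hB, consThree_zero, consThree_one] at hcell₂
  have hPp : 0 < ∏ k, (p - t k) := Finset.prod_pos fun k _ => htp k
  have hPq : 0 < ∏ k, (q - t k) := Finset.prod_pos fun k _ => htq k
  have hpq' : 0 < p - q := sub_pos.2 hpq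
  have hpb : 0 < p - b := by linarith
  have hqb : 0 < q - b := by linarith
  have hD : √(onesGram (consThree p b q t)) * divDiff p b q t =
      √(onesGram (consThree p b q t)) * (p ^ (m + 1) / ((p - b) * ((p - q) * ∏ k, (p - t k)))) -
      √(onesGram (consThree p b q t)) * (q ^ (m + 1) / ((q - b) * ((p - q) * ∏ k, (q - t k)))) := by
    rw [divDiff]
    field_simp
  rw [hD, ENNReal.ofReal_sub _ (by positivity), ENNReal.sub_mul fun _ _ => cornerVol_ne_top _,
    tsub_le_iff_right]
  erw [← hcell₁, ← hcell₂, ← hperm]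
  rw [sectionVol, centralHyperplane_inter_regSimplex]
  exact hle

/-- The projection of the section of the simplex to all but the first two coordinates. -/
def sectionShadow {m : ℕ} (a : Fin (m + 2) → ℝ) : Set (Fin m → ℝ) :=
  {y | (∀ k, 0 ≤ y k) ∧ ∑ k : Fin m, (a 0 - a k.succ.succ) * y k ≤ a 0 ∧
    ∑ k : Fin m, (a k.succ.succ - a 1) * y k ≤ -a 1}

theorem sectionVol_eq_volume_sectionShadow {m : ℕ} (a : Fin (m + 2) → ℝ) (h : a 1 < a 0) :
    sectionVol (n := m + 1) (WithLp.toLp 2 a) =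
      ENNReal.ofReal (√(onesGram a) / (a 0 - a 1)) * volume (sectionShadow a) := by
  have hd : 0 < a 0 - a 1 := sub_pos.2 h
  rw [sectionVol, centralHyperplane_inter_regSimplex]
  have := kVol_centralPlane_over a h.ne' (sectionShadow a)
  rw [abs_of_pos hd] at this
  rw [← this]
  simp only [Nat.add_sub_cancel]
  congr 1
  ext x
  refine and_congr_right fun hx => ?_
  simp only [sectionShadow, Set.mem_ofPred_eq]
  rw [← sub_nonneg, ← centralPlane_coord_one hx, mul_nonneg_iff_of_pos_left hd,
    ← sub_nonneg (b := ∑ k : Fin m, (a k.succ.succ - a 1) * x k.succ.succ),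
    ← centralPlane_coord_zero hx, mul_nonneg_iff_of_pos_left hd]
  exact ⟨fun H => ⟨fun k => H _, H 1, H 0⟩, fun H => Fin.cases H.2.2 (Fin.cases H.2.1 H.1)⟩

/-- Lowering `q` to `r` makes the two positive entries distinct even when `p = q`. Shrinking one
shadow coordinate by `(r - b) / (q - b)` preserves the constraint involving `b` exactly and only
relaxes the one involving `p`, so the shadow for `r` maps into the shadow for `q`. -/
theorem sectionVol_ge_of_two_pos_scaled {m : ℕ} {p b q r : ℝ} {t : Fin m → ℝ} (hr : 0 < r)
    (hrq : r < q) (hqp : q ≤ p) (hb : b ≤ 0) (ht : ∀ k, t k ≤ 0) :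
    ENNReal.ofReal (√(onesGram (consThree p b q t)) * ((r - b) / (q - b) * divDiff p b r t)) *
      cornerVol (m + 1) ≤ sectionVol (n := m + 2) (WithLp.toLp 2 (consThree p b q t)) := by
  have hp : 0 < p := by linarith
  have hpb : 0 < p - b := by linarith
  have hqb : 0 < q - b := by linarith
  have hrb : 0 < r - b := by linarith
  have hvr := sectionVol_ge_of_two_pos_lt hr (hrq.trans_le hqp) hb ht
  rw [sectionVol_eq_volume_sectionShadow (m := m + 1) _ (by simp; linarith)] at hvr ⊢
  simp only [consThree_zero, consThree_one] at hvr ⊢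
  set c : Fin (m + 1) → ℝ := Fin.cons ((r - b) / (q - b)) 1 with hc
  have hc0 : ∀ k, c k ≠ 0 := Fin.cases (by simp [hc, hrb.ne', hqb.ne']) (by simp [hc])
  have hprod : ∏ k, |c k| = (r - b) / (q - b) := by
    rw [Fin.prod_univ_succ]
    simp [hc, abs_of_pos, hrb, hqb]
  have hsub : sectionShadow (m := m + 1) (consThree p b r t) ⊆
      {y | (fun k => c k * y k) ∈ sectionShadow (m := m + 1) (consThree p b q t)} := by
    rintro y ⟨h0, h1, h2⟩
    rw [Fin.sum_univ_succ] at h1 h2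
    refine ⟨fun k => mul_nonneg ?_ (h0 k), ?_, ?_⟩
    · refine Fin.cases ?_ (fun k => ?_) k
      · simp only [hc, Fin.cons_zero]; positivity
      · simp [hc]
    · rw [Fin.sum_univ_succ]
      refine le_trans (add_le_add ?_ (le_of_eq ?_)) h1
      · change (p - q) * (c 0 * y 0) ≤ (p - r) * y 0
        have hle : (r - b) / (q - b) ≤ 1 := (div_le_one hqb).2 (by linarith)
        have : c 0 * y 0 ≤ y 0 := mul_le_of_le_one_left (h0 0) hle
        exact mul_le_mul (by linarith) this (mul_nonneg (by simp only [hc, Fin.cons_zero]; positivity)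
          (h0 0)) (by linarith)
      · refine Finset.sum_congr rfl fun k _ => ?_
        simp [hc]
    · rw [Fin.sum_univ_succ]
      refine le_trans (le_of_eq (congrArg₂ _ ?_ ?_)) h2
      · change (q - b) * ((r - b) / (q - b) * y 0) = (r - b) * y 0
        field_simp
      · refine Finset.sum_congr rfl fun k _ => ?_
        simp [hc]
  have hvol := measure_mono (μ := volume) hsub
  rw [volume_preimage_diagonal c hc0, hprod] at hvol
  have hgr : 0 < √(onesGram (consThree p b r t)) :=
    Real.sqrt_pos.2 (onesGram_pos (i := 0) (j := 1) (by simp; linarith))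
  set g := √(onesGram (consThree p b r t))
  set G := √(onesGram (consThree p b q t))
  have hG : 0 ≤ G := Real.sqrt_nonneg _
  have hchain := hvr.trans (mul_le_mul_right hvol _)
  -- This factor exchanges the Gram factor of `r` for that of `q` and undoes the scaling.
  have h3 := mul_le_mul_right hchain (ENNReal.ofReal (G / g * ((r - b) / (q - b))))
  rw [← mul_assoc, ← mul_assoc, ← mul_assoc, ← ENNReal.ofReal_mul (by positivity),
    ← ENNReal.ofReal_mul (by positivity), ← ENNReal.ofReal_mul (by positivity)] at h3
  have e1 : G / g * ((r - b) / (q - b)) * (g * divDiff p b r t) =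
      G * ((r - b) / (q - b) * divDiff p b r t) := by field_simp
  have e2 : G / g * ((r - b) / (q - b)) * (g / (p - b)) * (1 / ((r - b) / (q - b))) =
      G / (p - b) := by field_simp
  rwa [e1, e2] at h3

/-! ### Polynomial inequalities for the 2+3 and 2+2 sign patterns. -/

/-- This and the next two lemmas are endpoint cases of `two_three_normalized`, with `x * y * z`
replaced by `0`, `e ^ 2 / 3` and the Schur bound `(4 * e - 1) / 9`. Here a common factor `u` splits
off. -/
theorem section_quartic_zero {u e : ℝ} (hu : 0 ≤ u) (hu' : u ≤ 1 / 4) (he : 0 ≤ e)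
    (he' : e ≤ 1 / 4) :
    229 / 500 * (u ^ 3 + 2 * u ^ 2 + e * u * (2 - 2 * u) + e ^ 2 * u) ≤
      (u ^ 2 + e * u) * (7 / 5 - 209 / 250 * (u + e)) := by
  have : 229 / 500 * ((u - e) ^ 2 + 2 * (u + e)) ≤ (u + e) * (7 / 5 - 209 / 250 * (u + e)) := by
    nlinarith [mul_nonneg hu he]
  nlinarith [mul_le_mul_of_nonneg_left this hu]

theorem section_quartic_upper {u e : ℝ} (hu : 0 ≤ u) (hu' : u ≤ 1 / 4) (he : 0 ≤ e)
    (he' : e ≤ 1 / 3) :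
    229 / 500 * (u ^ 3 + 2 * u ^ 2 + e * u * (2 - 2 * u) + e ^ 2 * u +
      e ^ 2 / 3 * (2 - 5 * u + e) + (e ^ 2 / 3) ^ 2) ≤
      (u ^ 2 + e * u + e ^ 2 / 3 * (1 - u)) * (7 / 5 - 209 / 250 * (u + e)) := by
  have h1 := sub_nonneg.2 hu'
  have h2 := sub_nonneg.2 he'
  nlinarith [mul_nonneg hu he, mul_nonneg hu h1, mul_nonneg hu h2, mul_nonneg he h1,
    mul_nonneg he h2, mul_nonneg (mul_nonneg hu hu) h1, mul_nonneg (mul_nonneg hu hu) h2,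
    mul_nonneg (mul_nonneg he he) h1, mul_nonneg (mul_nonneg he he) h2,
    mul_nonneg (mul_nonneg hu he) h1, mul_nonneg (mul_nonneg hu he) h2]

theorem section_quartic_schur {u e : ℝ} (hu : 0 ≤ u) (hu' : u ≤ 1 / 4) (he : 1 / 4 ≤ e)
    (he' : e ≤ 1 / 3) :
    229 / 500 * (u ^ 3 + 2 * u ^ 2 + e * u * (2 - 2 * u) + e ^ 2 * u +
      (4 * e - 1) / 9 * (2 - 5 * u + e) + ((4 * e - 1) / 9) ^ 2) ≤
      (u ^ 2 + e * u + (4 * e - 1) / 9 * (1 - u)) * (7 / 5 - 209 / 250 * (u + e)) := by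
  have h1 := sub_nonneg.2 hu'
  have h2 := sub_nonneg.2 he'
  have h3 := sub_nonneg.2 he
  nlinarith [mul_nonneg hu h3, mul_nonneg hu h1, mul_nonneg hu h2, mul_nonneg h3 h1,
    mul_nonneg h3 h2, mul_nonneg (mul_nonneg hu hu) h1, mul_nonneg (mul_nonneg hu hu) h2,
    mul_nonneg (mul_nonneg h3 h3) h1, mul_nonneg (mul_nonneg h3 h3) h2,
    mul_nonneg (mul_nonneg hu h3) h1, mul_nonneg (mul_nonneg hu h3) h2]

/-- Schur's inequality on the simplex. -/
theorem schur_of_sum_eq_one {x y z : ℝ} (hx : 0 ≤ x) (hy : 0 ≤ y) (hz : 0 ≤ z)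
    (h : x + y + z = 1) : 4 * (x * y + y * z + z * x) ≤ 1 + 9 * (x * y * z) := by
  have ordered : ∀ {a b c : ℝ}, 0 ≤ c → a ≥ b → b ≥ c →
      0 ≤ a * (a - b) * (a - c) + b * (b - a) * (b - c) + c * (c - a) * (c - b) := by
    intro a b c hc hab hbc
    -- The sum equals `(a - b) ^ 2 * (a + b - c) + c * (a - c) * (b - c)`.
    have h1 := mul_nonneg (sub_nonneg.2 hab) (sub_nonneg.2 hab)
    have h2 := mul_nonneg h1 (by linarith : 0 ≤ a + b - c)
    have h3 := mul_nonneg hc (mul_nonneg (sub_nonneg.2 (hbc.trans hab)) (sub_nonneg.2 hbc))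
    linarith
  have key : 0 ≤ x * (x - y) * (x - z) + y * (y - x) * (y - z) + z * (z - x) * (z - y) := by
    rcases le_total x y with a | a <;> rcases le_total y z with b | b <;>
      rcases le_total x z with c | c
    · linarith [ordered hx b a]
    · linarith [ordered hx b a]
    · linarith [ordered hx b c]
    · linarith [ordered hz a c]
    · linarith [ordered hy c a]
    · linarith [ordered hy c b]
    · linarith [ordered hz a b]
    · linarith [ordered hz a b]
  have : x * (x - y) * (x - z) + y * (y - x) * (y - z) + z * (z - x) * (z - y) =
      (x + y + z) ^ 3 - 4 * (x + y + z) * (x * y + y * z + z * x) + 9 * (x * y * z) := by ring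
  rw [this, h] at key
  linarith

/-- The normalized inequality behind minimality for two positive and three negative entries. -/
theorem two_three_normalized {p q x y z T : ℝ} (hp : 0 ≤ p) (hq : 0 ≤ q) (hx : 0 ≤ x) (hy : 0 ≤ y)
    (hz : 0 ≤ z) (hpq : p + q = 1) (hxyz : x + y + z = 1) (hT : 0 ≤ T)
    (hT2 : T ^ 2 = p ^ 2 + q ^ 2 + x ^ 2 + y ^ 2 + z ^ 2) :
    229 / 500 * (((p + x) * (p + y) * (p + z)) * ((q + x) * (q + y) * (q + z))) ≤
      ((p * q) ^ 2 + (x * y + y * z + z * x) * (p * q) + x * y * z * (p ^ 2 + p * q + q ^ 2)) *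
        T := by
  obtain ⟨u, hu⟩ : ∃ u, u = p * q := ⟨_, rfl⟩
  obtain ⟨e, he⟩ : ∃ e, e = x * y + y * z + z * x := ⟨_, rfl⟩
  obtain ⟨c, hc⟩ : ∃ c, c = x * y * z := ⟨_, rfl⟩
  have hu0 : 0 ≤ u := hu ▸ mul_nonneg hp hq
  have he0 : 0 ≤ e := by rw [he]; positivity
  have hc0 : 0 ≤ c := by rw [hc]; positivity
  have hu1 : u ≤ 1 / 4 := by
    have : q = 1 - p := by linarith
    rw [hu, this]; nlinarith [sq_nonneg (p - 1 / 2)]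
  have he1 : e ≤ 1 / 3 := by
    have : (x + y + z) ^ 2 = 1 := by rw [hxyz]; norm_num
    nlinarith [sq_nonneg (x - y), sq_nonneg (y - z), sq_nonneg (z - x)]
  have hcu : c ≤ e ^ 2 / 3 := by
    have h : e ^ 2 - 3 * c * (x + y + z) =
        ((x * y - y * z) ^ 2 + (y * z - z * x) ^ 2 + (z * x - x * y) ^ 2) / 2 := by
      rw [he, hc]; ring
    rw [hxyz] at h
    nlinarith [sq_nonneg (x * y - y * z), sq_nonneg (y * z - z * x), sq_nonneg (z * x - x * y)]
  have hcs : 4 * e ≤ 1 + 9 * c := by rw [he, hc]; exact schur_of_sum_eq_one hx hy hz hxyz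
  have hTu : T ^ 2 = 2 - 2 * u - 2 * e := by
    have h1 : (p + q) ^ 2 = 1 := by rw [hpq]; norm_num
    have h2 : (x + y + z) ^ 2 = 1 := by rw [hxyz]; norm_num
    rw [hT2, hu, he]
    linear_combination h1 + h2
  -- A line just below the chord of the concave function `√(2 - 2 * w)` over `[0, 7 / 12]`, where `7
  -- / 12 = 1 / 4 + 1 / 3` is the largest possible `u + e`.
  have hTl : 7 / 5 - 209 / 250 * (u + e) ≤ T := by
    refine le_of_sq_le_sq ?_ hT
    rw [hTu]
    nlinarith [mul_nonneg (add_nonneg hu0 he0) (by linarith : 0 ≤ 7 / 12 - (u + e))]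
  have hN : (p * q) ^ 2 + (x * y + y * z + z * x) * (p * q) +
      x * y * z * (p ^ 2 + p * q + q ^ 2) = u ^ 2 + e * u + c * (1 - u) := by
    rw [← he, ← hc, ← hu]
    have h1 : (p + q) ^ 2 = 1 := by rw [hpq]; norm_num
    linear_combination c * h1 + 2 * c * hu
  have hD : ((p + x) * (p + y) * (p + z)) * ((q + x) * (q + y) * (q + z)) =
      u ^ 3 + 2 * u ^ 2 + e * u * (2 - 2 * u) + e ^ 2 * u + c * (2 - 5 * u + e) + c ^ 2 := by
    have hP : ∀ w, (w + x) * (w + y) * (w + z) = w ^ 3 + w ^ 2 + e * w + c := fun w => by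
      rw [he, hc]; linear_combination w ^ 2 * hxyz
    have hqp : q = 1 - p := by linarith
    rw [hP, hP, hu, hqp]
    ring
  rw [hN, hD]
  have hN0 : 0 ≤ u ^ 2 + e * u + c * (1 - u) := by
    have : 0 ≤ c * (1 - u) := mul_nonneg hc0 (by linarith)
    positivity
  refine le_trans ?_ (mul_le_mul_of_nonneg_left hTl hN0)
  -- The right side minus the left is concave in `c`, so it is nonnegative between `l` and `e ^ 2 /
  -- 3` once it is at both ends.
  have concave : ∀ l, l ≤ c →
      229 / 500 * (u ^ 3 + 2 * u ^ 2 + e * u * (2 - 2 * u) + e ^ 2 * u + l * (2 - 5 * u + e) +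
        l ^ 2) ≤ (u ^ 2 + e * u + l * (1 - u)) * (7 / 5 - 209 / 250 * (u + e)) →
      229 / 500 * (u ^ 3 + 2 * u ^ 2 + e * u * (2 - 2 * u) + e ^ 2 * u + c * (2 - 5 * u + e) +
        c ^ 2) ≤ (u ^ 2 + e * u + c * (1 - u)) * (7 / 5 - 209 / 250 * (u + e)) := by
    intro l hl h
    rcases hl.eq_or_lt with rfl | hlt
    · exact h
    have hup := section_quartic_upper hu0 hu1 he0 he1
    generalize e ^ 2 / 3 = r at hup hcu
    have hlr : 0 < r - l := by linarith
    refine le_of_mul_le_mul_left ?_ hlr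
    linear_combination mul_le_mul_of_nonneg_left h (sub_nonneg.2 hcu) +
      mul_le_mul_of_nonneg_left hup (sub_nonneg.2 hl) +
      229 / 500 * mul_nonneg (mul_nonneg (sub_nonneg.2 hcu) (sub_nonneg.2 hl)) hlr.le
  rcases le_total e (1 / 4) with h4 | h4
  · exact concave 0 hc0 (by have := section_quartic_zero hu0 hu1 he0 h4; linarith)
  · exact concave ((4 * e - 1) / 9) (by linarith) (section_quartic_schur hu0 hu1 h4 he1)

/-- Dividing all entries by `p + q` reduces to the normalized form, where the unit norm becomes `T =
1 / (p + q)`. -/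
theorem two_three_bound {p q x y z : ℝ} (hp : 0 < p) (hq : 0 < q) (hx : 0 ≤ x) (hy : 0 ≤ y)
    (hz : 0 ≤ z) (hs : p + q = x + y + z)
    (hn : p ^ 2 + q ^ 2 + x ^ 2 + y ^ 2 + z ^ 2 = 1) :
    229 / 500 ≤ ((x + y + z) * (p * q) ^ 2 + (x * y + y * z + z * x) * (p * q) * (p + q) +
      x * y * z * (p ^ 2 + p * q + q ^ 2)) /
      (((p + x) * (p + y) * (p + z)) * ((q + x) * (q + y) * (q + z))) := by
  rw [le_div_iff₀ (by positivity), ← hs]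
  have hs0 : 0 < p + q := by positivity
  set s := p + q with hsdef
  have h := two_three_normalized (p := p / s) (q := q / s) (x := x / s) (y := y / s) (z := z / s)
    (T := 1 / s) (by positivity) (by positivity) (by positivity) (by positivity) (by positivity)
    (by rw [← add_div]; exact div_self hs0.ne')
    (by rw [← add_div, ← add_div, ← hs]; exact div_self hs0.ne') (by positivity)
    (by simp only [div_pow, ← add_div, hn, one_pow])
  simp only [← add_div] at h
  have h' := mul_le_mul_of_nonneg_right h (pow_nonneg hs0.le 6)
  field_simp at h'
  linarith

theorem two_two_bound {p q x y : ℝ} (hp : 0 < p) (hq : 0 < q) (hx : 0 ≤ x) (hy : 0 ≤ y)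
    (hs : p + q = x + y) (hn : p ^ 2 + q ^ 2 + x ^ 2 + y ^ 2 = 1) :
    122 / 250 ≤ ((x + y) * (p * q) + x * y * (p + q)) /
      (((p + x) * (p + y)) * ((q + x) * (q + y))) := by
  rw [le_div_iff₀ (by positivity)]
  have hs0 : 0 < p + q := by positivity
  obtain ⟨s, hsd⟩ : ∃ s, s = p + q := ⟨_, rfl⟩
  obtain ⟨u, hu⟩ : ∃ u, u = p * q := ⟨_, rfl⟩
  obtain ⟨e, he⟩ : ∃ e, e = x * y := ⟨_, rfl⟩
  have hu0 : 0 ≤ u := by rw [hu]; positivity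
  have he0 : 0 ≤ e := by rw [he]; positivity
  have hD : ((p + x) * (p + y)) * ((q + x) * (q + y)) =
      (u - e) ^ 2 + 2 * s ^ 2 * (u + e) := by
    have hP : ∀ w, (w + x) * (w + y) = w ^ 2 + s * w + e := fun w => by
      rw [he, hsd, hs]; ring
    rw [hP, hP, hu, hsd]; ring
  have hu4 : 4 * u ≤ s ^ 2 := by rw [hu, hsd]; nlinarith [sq_nonneg (p - q)]
  have he4 : 4 * e ≤ s ^ 2 := by rw [he, hsd, hs]; nlinarith [sq_nonneg (x - y)]
  have hn' : 2 * s ^ 2 - 2 * (u + e) = 1 := by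
    rw [← hn, hu, he]
    have : s ^ 2 = (x + y) ^ 2 := by rw [hsd, hs]
    linear_combination this + (s + p + q) * hsd
  have hN : (x + y) * (p * q) + x * y * (p + q) = s * (u + e) := by
    rw [hu, he, ← hs, hsd]; ring
  rw [hD, hN]
  -- Equivalent to `2 * u ^ 2 + 2 * e ^ 2 ≤ s ^ 2 / 2 * (u + e)`, which follows from `u, e ≤ s ^ 2 /
  -- 4`. It leaves a common factor `u + e`.
  have hdiff : (u - e) ^ 2 ≤ (s ^ 2 / 2 - (u + e)) * (u + e) := by nlinarith
  have hs1 : s ≤ 1 := le_of_sq_le_sq (by linarith) zero_le_one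
  have hsl : 7 / 10 ≤ s := le_of_sq_le_sq (by linarith) (by linarith)
  -- As `u + e = s ^ 2 - 1 / 2`, this is a quadratic inequality in `s` alone, needed only on `[7 /
  -- 10, 1]`.
  have hkey : 122 / 250 * (s ^ 2 / 2 - (u + e) + 2 * s ^ 2) ≤ s := by
    linarith [mul_nonneg (sub_nonneg.2 hs1) (sub_nonneg.2 hsl)]
  linear_combination mul_le_mul_of_nonneg_right hkey (add_nonneg hu0 he0) + 122 / 250 * hdiff

/-! ### Passage to the limit, with explicit divided differences. -/

/-- Letting `r` increase to `q` treats `q < p` and `q = p` together. The formulas below, with `p -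
q` cancelled, supply `F`. -/
theorem sectionVol_ge_of_tendsto {m : ℕ} {p b q F : ℝ} {t : Fin m → ℝ} (hq : 0 < q) (hqp : q ≤ p)
    (hb : b ≤ 0) (ht : ∀ k, t k ≤ 0)
    (hF : Tendsto (fun r => divDiff p b r t) (𝓝[<] q) (𝓝 F)) :
    ENNReal.ofReal (√(onesGram (consThree p b q t)) * F) * cornerVol (m + 1) ≤
      sectionVol (n := m + 2) (WithLp.toLp 2 (consThree p b q t)) := by
  have hqb : q - b ≠ 0 := by linarith
  have h1 : Tendsto (fun r => (r - b) / (q - b)) (𝓝[<] q) (𝓝 1) := by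
    have : ContinuousAt (fun r : ℝ => (r - b) / (q - b)) q := by fun_prop
    have h := this.tendsto
    rw [div_self hqb] at h
    exact h.mono_left nhdsWithin_le_nhds
  have h2 := ((h1.mul hF).const_mul √(onesGram (consThree p b q t)))
  rw [one_mul] at h2
  have h3 := ENNReal.Tendsto.mul_const (ENNReal.tendsto_ofReal h2)
    (Or.inr (cornerVol_ne_top (m + 1)))
  refine le_of_tendsto h3 ?_
  filter_upwards [Ioo_mem_nhdsLT hq] with r hr
  exact sectionVol_ge_of_two_pos_scaled hr.1 hr.2 hqp hb ht

theorem sectionVol_ge_two_two {p q x y : ℝ} (hq : 0 < q) (hqp : q ≤ p) (hx : 0 ≤ x) (hy : 0 ≤ y) :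
    ENNReal.ofReal (√(onesGram (consThree p (-x) q ![-y])) *
      (((x + y) * (p * q) + x * y * (p + q)) / (((p + x) * (p + y)) * ((q + x) * (q + y))))) *
      cornerVol 2 ≤ sectionVol (n := 3) (WithLp.toLp 2 (consThree p (-x) q ![-y])) := by
  refine sectionVol_ge_of_tendsto (m := 1) hq hqp (by linarith) (by simpa using hy) ?_
  have hc : ContinuousAt (fun q => ((x + y) * (p * q) + x * y * (p + q)) /
      (((p + x) * (p + y)) * ((q + x) * (q + y)))) q := by
    have : ((p + x) * (p + y)) * ((q + x) * (q + y)) ≠ 0 := by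
      have : 0 < p := hq.trans_le hqp
      positivity
    fun_prop (disch := assumption)
  refine (hc.tendsto.mono_left nhdsWithin_le_nhds).congr' ?_
  filter_upwards [Ioo_mem_nhdsLT hq] with r hr
  have hr0 := hr.1
  have hp : 0 < p := hq.trans_le hqp
  have hpr : p - r ≠ 0 := (sub_pos.2 (hr.2.trans_le hqp)).ne'
  have h1 : p + x ≠ 0 := by positivity
  have h2 : p + y ≠ 0 := by positivity
  have h3 : r + x ≠ 0 := by positivity
  have h4 : r + y ≠ 0 := by positivity
  simp [divDiff]
  field_simp
  ring

theorem sectionVol_ge_two_three {p q x y z : ℝ} (hq : 0 < q) (hqp : q ≤ p) (hx : 0 ≤ x)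
    (hy : 0 ≤ y) (hz : 0 ≤ z) :
    ENNReal.ofReal (√(onesGram (consThree p (-x) q ![-y, -z])) *
      (((x + y + z) * (p * q) ^ 2 + (x * y + y * z + z * x) * (p * q) * (p + q) +
      x * y * z * (p ^ 2 + p * q + q ^ 2)) /
      (((p + x) * (p + y) * (p + z)) * ((q + x) * (q + y) * (q + z))))) *
      cornerVol 3 ≤ sectionVol (n := 4) (WithLp.toLp 2 (consThree p (-x) q ![-y, -z])) := by
  refine sectionVol_ge_of_tendsto (m := 2) hq hqp (by linarith)
    (by simp [Fin.forall_fin_two, hy, hz]) ?_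
  have hc : ContinuousAt (fun q => ((x + y + z) * (p * q) ^ 2 +
      (x * y + y * z + z * x) * (p * q) * (p + q) + x * y * z * (p ^ 2 + p * q + q ^ 2)) /
      (((p + x) * (p + y) * (p + z)) * ((q + x) * (q + y) * (q + z)))) q := by
    have : ((p + x) * (p + y) * (p + z)) * ((q + x) * (q + y) * (q + z)) ≠ 0 := by
      have : 0 < p := hq.trans_le hqp
      positivity
    fun_prop (disch := assumption)
  refine (hc.tendsto.mono_left nhdsWithin_le_nhds).congr' ?_
  filter_upwards [Ioo_mem_nhdsLT hq] with r hr
  have hr0 := hr.1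
  have hp : 0 < p := hq.trans_le hqp
  have hpr : p - r ≠ 0 := (sub_pos.2 (hr.2.trans_le hqp)).ne'
  have h1 : p + x ≠ 0 := by positivity
  have h2 : p + y ≠ 0 := by positivity
  have h3 : r + x ≠ 0 := by positivity
  have h4 : r + y ≠ 0 := by positivity
  have h5 : p + z ≠ 0 := by positivity
  have h6 : r + z ≠ 0 := by positivity
  simp [divDiff, Fin.prod_univ_two]
  field_simp
  ring

/-! ### The section at `aMin` and its minimality when one entry has its own sign. -/

theorem sum_sq_eq_one {n : ℕ} {a : EuclideanSpace ℝ (Fin n)} (h : ‖a‖ = 1) :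
    ∑ j, a j ^ 2 = 1 := by
  rw [← EuclideanSpace.real_norm_sq_eq, h, one_pow]

theorem onesGram_eq {n : ℕ} {a : EuclideanSpace ℝ (Fin n)} (h : ‖a‖ = 1) (hs : ∑ j, a j = 0) :
    onesGram a = n := by
  simp [onesGram, sum_sq_eq_one h, hs]

theorem aMin_mem_centralNormals (m : ℕ) : aMin (m + 1) ∈ centralNormals (m + 1) := by
  have hm : (0 : ℝ) < m + 1 := by positivity
  have h2 : (0 : ℝ) < m + 1 + 1 := by positivity
  have hsm : ((m : ℝ) + 1) ≠ 0 := hm.ne'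
  constructor
  · rw [EuclideanSpace.norm_eq, Real.sqrt_eq_one, Fin.sum_univ_succ]
    simp [aMin]
    rw [Real.sq_sqrt (by positivity), Real.sq_sqrt (by positivity)]
    field_simp
  · rw [Fin.sum_univ_succ]
    simp [aMin]
    have e : √(((m : ℝ) + 1) / (m + 1 + 1)) * √(((m : ℝ) + 1) * (m + 1 + 1)) = m + 1 := by
      rw [← Real.sqrt_mul (by positivity), ← Real.sqrt_sq hm.le]
      congr 1
      field_simp
      rw [Real.sqrt_sq hm.le]
    have : √(((m : ℝ) + 1) * (m + 1 + 1)) ≠ 0 := (Real.sqrt_pos.2 (by positivity)).ne'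
    field_simp
    linarith

/-- The first coordinate of `aMin (m + 1)`. -/
noncomputable def minHead (m : ℕ) : ℝ := √(((m : ℝ) + 1) / (m + 2))

theorem minHead_pos (m : ℕ) : 0 < minHead m := Real.sqrt_pos.2 (by positivity)

theorem minHead_sq (m : ℕ) : minHead m ^ 2 = ((m : ℝ) + 1) / (m + 2) :=
  Real.sq_sqrt (by positivity)

theorem aMin_zero (m : ℕ) : aMin (m + 1) 0 = minHead m := by
  simp only [aMin, minHead, if_true]
  push_cast
  ring_nf

theorem aMin_succ_neg (m : ℕ) (k : Fin (m + 1)) : aMin (m + 1) k.succ < 0 := by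
  have : (0 : ℝ) < 1 / √(((m + 1 : ℕ) : ℝ) * (((m + 1 : ℕ) : ℝ) + 1)) := by positivity
  simpa [aMin, Fin.succ_ne_zero] using this

theorem sectionVol_aMin (m : ℕ) :
    sectionVol (aMin (m + 1)) =
      ENNReal.ofReal (√((m : ℝ) + 2) * minHead m ^ (2 * m + 1)) * cornerVol m := by
  obtain ⟨hn, hs⟩ := aMin_mem_centralNormals m
  have h0 : 0 < aMin (m + 1) 0 := by rw [aMin_zero]; exact minHead_pos m
  have hneg : ∀ j, j ≠ 0 → aMin (m + 1) j ≤ 0 := fun j hj => by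
    obtain ⟨k, rfl⟩ := Fin.exists_succ_eq.2 hj
    exact (aMin_succ_neg m k).le
  rw [sectionVol_of_one_pos _ h0 hneg, onesGram_eq hn hs, aMin_zero]
  have hw := minHead_pos m
  have hconst : ∀ k : Fin (m + 1), aMin (m + 1) k.succ = aMin (m + 1) (Fin.succ 0) := fun k => by
    simp [aMin, Fin.succ_ne_zero]
  -- The equal negative entries are `-minHead m / (m + 1)`, and `minHead m ^ 2 = (m + 1) / (m + 2)`.
  have hk : ∀ k : Fin (m + 1), minHead m - aMin (m + 1) k.succ = (minHead m)⁻¹ := fun k => by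
    rw [Fin.sum_univ_succ, aMin_zero] at hs
    simp only [hconst, Finset.sum_const, Finset.card_univ, Fintype.card_fin, nsmul_eq_mul] at hs
    rw [hconst k]
    have hw2 := minHead_sq m
    have hm : ((m : ℝ) + 1) ≠ 0 := by positivity
    push_cast at hs
    have : aMin (m + 1) (Fin.succ 0) = -minHead m / (m + 1) := by
      field_simp; linarith
    rw [this]
    field_simp
    rw [hw2]
    field_simp
    ring
  simp only [hk, Finset.prod_const, Finset.card_univ, Fintype.card_fin]
  congr 3
  · push_cast; ring_nf
  · rw [inv_pow, div_inv_eq_mul, ← pow_add]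
    congr 1
    ring

theorem prod_le_mean_pow {m : ℕ} (z : Fin (m + 1) → ℝ) (hz : ∀ k, 0 ≤ z k) :
    ∏ k, z k ≤ ((∑ k, z k) / (m + 1)) ^ (m + 1) := by
  have h := Real.geom_mean_le_arith_mean Finset.univ (fun _ => (1 : ℝ)) z (by simp)
    (by simp; positivity) (by simpa using hz)
  simp only [Real.rpow_one, one_mul, Finset.sum_const, Finset.card_univ, Fintype.card_fin,
    nsmul_eq_mul, mul_one] at h
  have h' := pow_le_pow_left₀ (by
    exact Real.rpow_nonneg (Finset.prod_nonneg fun k _ => hz k) _) h (m + 1)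
  rw [Real.rpow_inv_natCast_pow (Finset.prod_nonneg fun k _ => hz k) (by simp)] at h'
  simpa using h'

theorem sectionVol_aMin_le_of_head {m : ℕ} {a : EuclideanSpace ℝ (Fin (m + 2))} (hn : ‖a‖ = 1)
    (hs : ∑ j, a j = 0) (hneg : ∀ j, j ≠ 0 → a j ≤ 0) :
    sectionVol (aMin (m + 1)) ≤ sectionVol a := by
  have hsq := sum_sq_eq_one hn
  have hsum := hs
  rw [Fin.sum_univ_succ] at hs hsq
  have hneg' : ∀ k : Fin (m + 1), a k.succ ≤ 0 := fun k => hneg _ (Fin.succ_ne_zero k)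
  have hcs := sq_sum_le_card_mul_sum_sq (s := Finset.univ) (f := fun k : Fin (m + 1) => a k.succ)
  simp only [Finset.card_univ, Fintype.card_fin] at hcs
  push_cast at hcs
  have hge : 0 ≤ a 0 := by
    have := Finset.sum_nonpos fun (k : Fin (m + 1)) (_ : k ∈ Finset.univ) => hneg' k
    linarith
  have hpos : 0 < a 0 := by
    refine hge.lt_of_ne fun h0 => ?_
    rw [← h0] at hs hsq
    rw [zero_add] at hs
    have hz := (Finset.sum_eq_zero_iff_of_nonpos fun k _ => hneg' k).1 hs
    rw [Finset.sum_congr rfl fun k hk => by rw [hz k hk]] at hsq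
    simp at hsq
  have hw := minHead_pos m
  -- Cauchy-Schwarz on the other entries reads `a 0 ^ 2 ≤ (m + 1) * (1 - a 0 ^ 2)`.
  have hle : a 0 ≤ minHead m := by
    refine le_of_sq_le_sq ?_ hw.le
    rw [minHead_sq, le_div_iff₀ (by positivity)]
    have e1 : ∑ k : Fin (m + 1), a k.succ = -a 0 := by linarith
    have e2 : ∑ k : Fin (m + 1), a k.succ ^ 2 = 1 - a 0 ^ 2 := by linarith
    rw [e1, e2] at hcs
    linarith
  rw [sectionVol_aMin, sectionVol_of_one_pos a hpos hneg, onesGram_eq hn hsum]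
  push_cast
  gcongr
  have hprod := prod_le_mean_pow (fun k : Fin (m + 1) => a 0 - a k.succ)
    fun k => by linarith [hneg' k]
  have hmean : (∑ k : Fin (m + 1), (a 0 - a k.succ)) / (m + 1) = a 0 / minHead m ^ 2 := by
    have e1 : ∑ k : Fin (m + 1), a k.succ = -a 0 := by linarith
    rw [Finset.sum_sub_distrib, e1, minHead_sq]
    simp
    field_simp
    ring
  rw [hmean] at hprod
  have hP : 0 < ∏ k : Fin (m + 1), (a 0 - a k.succ) :=
    Finset.prod_pos fun k _ => by linarith [hneg' k]
  rw [le_div_iff₀ hP]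
  calc minHead m ^ (2 * m + 1) * ∏ k : Fin (m + 1), (a 0 - a k.succ)
      ≤ minHead m ^ (2 * m + 1) * (a 0 / minHead m ^ 2) ^ (m + 1) := by gcongr
    _ = a 0 ^ m * (a 0 / minHead m) := by
        rw [div_pow, ← pow_mul, pow_succ (a 0) m, show 2 * (m + 1) = 2 * m + 1 + 1 by ring,
          pow_succ _ (2 * m + 1)]
        field_simp
    _ ≤ a 0 ^ m * 1 := by
        gcongr
        exact (div_le_one hw).2 hle
    _ = a 0 ^ m := mul_one _

theorem norm_permute {n : ℕ} (a : EuclideanSpace ℝ (Fin n)) (σ : Equiv.Perm (Fin n)) :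
    ‖(WithLp.toLp 2 (a ∘ σ) : EuclideanSpace ℝ (Fin n))‖ = ‖a‖ := by
  simp only [EuclideanSpace.norm_eq, Function.comp_apply]
  rw [Equiv.sum_comp σ fun j => ‖a j‖ ^ 2]

theorem sectionVol_aMin_le_of_one_pos {m : ℕ} {a : EuclideanSpace ℝ (Fin (m + 2))} (hn : ‖a‖ = 1)
    (hs : ∑ j, a j = 0) (i : Fin (m + 2)) (hneg : ∀ j, j ≠ i → a j ≤ 0) :
    sectionVol (aMin (m + 1)) ≤ sectionVol a := by
  rw [← sectionVol_permute a (Equiv.swap 0 i)]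
  refine sectionVol_aMin_le_of_head ((norm_permute a _).trans hn) ?_ fun j hj => ?_
  · rw [← hs]; exact Equiv.sum_comp (Equiv.swap 0 i) fun j => a j
  · refine hneg _ fun h => hj ?_
    rw [Equiv.swap_apply_eq_iff, Equiv.swap_apply_right] at h
    exact h

theorem sectionVol_aMin_le_of_one_neg {m : ℕ} {a : EuclideanSpace ℝ (Fin (m + 2))} (hn : ‖a‖ = 1)
    (hs : ∑ j, a j = 0) (i : Fin (m + 2)) (hpos : ∀ j, j ≠ i → 0 ≤ a j) :
    sectionVol (aMin (m + 1)) ≤ sectionVol a := by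
  rw [← sectionVol_neg a]
  exact sectionVol_aMin_le_of_one_pos ((norm_neg a).trans hn) (by simpa using hs) i
    fun j hj => by simpa using hpos j hj

theorem isLocalMinOn_aMin (m : ℕ) :
    IsLocalMinOn sectionVol (centralNormals (m + 1)) (aMin (m + 1)) := by
  have h : ∀ᶠ a : EuclideanSpace ℝ (Fin (m + 2)) in 𝓝 (aMin (m + 1)), ∀ k : Fin (m + 1),
      a k.succ < 0 := eventually_all.2 fun k => by
    have hc : Continuous fun a : EuclideanSpace ℝ (Fin (m + 2)) => a k.succ := by fun_prop
    exact hc.continuousAt.eventually_lt continuousAt_const (aMin_succ_neg m k)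
  filter_upwards [nhdsWithin_le_nhds h, self_mem_nhdsWithin] with a ha hmem
  refine sectionVol_aMin_le_of_head hmem.1 hmem.2 fun j hj => ?_
  obtain ⟨k, rfl⟩ := Fin.exists_succ_eq.2 hj
  exact (ha k).le

/-! ### Global minimality in dimensions 2, 3 and 4. -/

theorem sectionVol_aMin_le_of_two_two {a : EuclideanSpace ℝ (Fin 4)} (hn : ‖a‖ = 1)
    (hs : ∑ j, a j = 0) (τ : Equiv.Perm (Fin 4)) (h2 : 0 < a (τ 2)) (h0 : a (τ 2) ≤ a (τ 0))
    (h1 : a (τ 1) ≤ 0) (h3 : a (τ 3) ≤ 0) : sectionVol (aMin 3) ≤ sectionVol a := by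
  have hn' := sum_sq_eq_one hn
  have hG := onesGram_eq hn hs
  rw [← onesGram_permute _ τ] at hG
  rw [← Equiv.sum_comp τ] at hs hn'
  rw [Fin.sum_univ_four] at hs hn'
  rw [← sectionVol_permute a τ, sectionVol_aMin 2]
  have hv : a ∘ τ = consThree (a (τ 0)) (- -a (τ 1)) (a (τ 2)) ![- -a (τ 3)] := by
    ext j; fin_cases j <;> simp [consThree]
  have key := sectionVol_ge_two_two h2 h0 (neg_nonneg.2 h1) (neg_nonneg.2 h3)
  rw [← hv, hG] at key
  refine le_trans ?_ key
  have hb := two_two_bound (h2.trans_le h0) h2 (neg_nonneg.2 h1) (neg_nonneg.2 h3)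
    (by linarith) (by linarith)
  -- Here `minHead 2 = √3 / 2`, whose fifth power is about `0.4871`, just below `122 / 250 = 0.488`.
  have hm : minHead 2 ≤ 8661 / 10000 := by
    refine le_of_sq_le_sq ?_ (by norm_num)
    rw [minHead_sq]; norm_num
  have hm' : minHead 2 ^ (2 * 2 + 1) ≤ 122 / 250 :=
    (pow_le_pow_left₀ (minHead_pos 2).le hm _).trans (by norm_num)
  have hc : ((2 : ℕ) : ℝ) + 2 = (4 : ℕ) := by norm_num
  rw [hc]
  gcongr
  exact hm'.trans hb

theorem sectionVol_aMin_le_of_two_three {a : EuclideanSpace ℝ (Fin 5)} (hn : ‖a‖ = 1)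
    (hs : ∑ j, a j = 0) (τ : Equiv.Perm (Fin 5)) (h2 : 0 < a (τ 2)) (h0 : a (τ 2) ≤ a (τ 0))
    (h1 : a (τ 1) ≤ 0) (h3 : a (τ 3) ≤ 0) (h4 : a (τ 4) ≤ 0) :
    sectionVol (aMin 4) ≤ sectionVol a := by
  have hn' := sum_sq_eq_one hn
  have hG := onesGram_eq hn hs
  rw [← onesGram_permute _ τ] at hG
  rw [← Equiv.sum_comp τ] at hs hn'
  rw [Fin.sum_univ_five] at hs hn'
  rw [← sectionVol_permute a τ, sectionVol_aMin 3]
  have hv : a ∘ τ = consThree (a (τ 0)) (- -a (τ 1)) (a (τ 2)) ![- -a (τ 3), - -a (τ 4)] := by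
    ext j; fin_cases j <;> simp [consThree]
  have key := sectionVol_ge_two_three h2 h0 (neg_nonneg.2 h1) (neg_nonneg.2 h3) (neg_nonneg.2 h4)
  rw [← hv, hG] at key
  refine le_trans ?_ key
  have hb := two_three_bound (h2.trans_le h0) h2 (neg_nonneg.2 h1) (neg_nonneg.2 h3)
    (neg_nonneg.2 h4) (by linarith) (by linarith)
  -- Here `minHead 3 = 2 / √5`, whose seventh power is about `0.45795`. The margin below `229 / 500
  -- = 0.458` is thin, hence the extra digit.
  have hm : minHead 3 ≤ 89443 / 100000 := by
    refine le_of_sq_le_sq ?_ (by norm_num)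
    rw [minHead_sq]; norm_num
  have hm' : minHead 3 ^ (2 * 3 + 1) ≤ 229 / 500 :=
    (pow_le_pow_left₀ (minHead_pos 3).le hm _).trans (by norm_num)
  have hc : ((3 : ℕ) : ℝ) + 2 = (5 : ℕ) := by norm_num
  rw [hc]
  gcongr
  exact hm'.trans hb

theorem exists_monotone_permute {n : ℕ} (a : EuclideanSpace ℝ (Fin (n + 1))) (hn : ‖a‖ = 1)
    (hs : ∑ j, a j = 0) : ∃ b : EuclideanSpace ℝ (Fin (n + 1)), ‖b‖ = 1 ∧ ∑ j, b j = 0 ∧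
      Monotone b.ofLp ∧ sectionVol b = sectionVol a :=
  ⟨WithLp.toLp 2 (a ∘ Tuple.sort a.ofLp), (norm_permute a _).trans hn,
    (Equiv.sum_comp (Tuple.sort a.ofLp) fun j => a j).trans hs, Tuple.monotone_sort a.ofLp,
    sectionVol_permute a _⟩

theorem sectionVol_aMin_two_le {a : EuclideanSpace ℝ (Fin 3)} (hn : ‖a‖ = 1)
    (hs : ∑ j, a j = 0) : sectionVol (aMin 2) ≤ sectionVol a := by
  obtain ⟨b, hn, hs, hb, hv⟩ := exists_monotone_permute a hn hs
  rw [← hv]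
  have h12 : b 1 ≤ b 2 := hb (by decide)
  have h01 : b 0 ≤ b 1 := hb (by decide)
  rcases le_total (b 1) 0 with h | h
  · exact sectionVol_aMin_le_of_one_pos hn hs 2 fun j hj => by
      fin_cases j <;> simp at hj ⊢ <;> linarith
  · exact sectionVol_aMin_le_of_one_neg hn hs 0 fun j hj => by
      fin_cases j <;> simp at hj ⊢ <;> linarith

theorem sectionVol_aMin_three_le {a : EuclideanSpace ℝ (Fin 4)} (hn : ‖a‖ = 1)
    (hs : ∑ j, a j = 0) : sectionVol (aMin 3) ≤ sectionVol a := by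
  obtain ⟨b, hn, hs, hb, hv⟩ := exists_monotone_permute a hn hs
  rw [← hv]
  have h01 : b 0 ≤ b 1 := hb (by decide)
  have h12 : b 1 ≤ b 2 := hb (by decide)
  have h23 : b 2 ≤ b 3 := hb (by decide)
  rcases le_or_gt (b 2) 0 with h | h
  · exact sectionVol_aMin_le_of_one_pos hn hs 3 fun j hj => by
      fin_cases j <;> simp at hj ⊢ <;> linarith
  rcases le_total (b 1) 0 with h' | h'
  -- The permutation puts the larger positive entry in position 0, the other in position 2, and a
  -- nonpositive one in position 1, as `consThree` expects.
  · exact sectionVol_aMin_le_of_two_two hn hs (Equiv.ofBijective ![3, 0, 2, 1] (by decide))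
      h h23 (h01.trans h') h'
  · exact sectionVol_aMin_le_of_one_neg hn hs 0 fun j hj => by
      fin_cases j <;> simp at hj ⊢ <;> linarith

theorem sectionVol_aMin_four_le {a : EuclideanSpace ℝ (Fin 5)} (hn : ‖a‖ = 1)
    (hs : ∑ j, a j = 0) : sectionVol (aMin 4) ≤ sectionVol a := by
  obtain ⟨b, hn, hs, hb, hv⟩ := exists_monotone_permute a hn hs
  rw [← hv]
  have h01 : b 0 ≤ b 1 := hb (by decide)
  have h12 : b 1 ≤ b 2 := hb (by decide)
  have h23 : b 2 ≤ b 3 := hb (by decide)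
  have h34 : b 3 ≤ b 4 := hb (by decide)
  rcases le_or_gt (b 3) 0 with h | h
  · exact sectionVol_aMin_le_of_one_pos hn hs 4 fun j hj => by
      fin_cases j <;> simp at hj ⊢ <;> linarith
  rcases le_total (b 2) 0 with h' | h'
  · exact sectionVol_aMin_le_of_two_three hn hs (Equiv.ofBijective ![4, 0, 3, 1, 2] (by decide))
      h h34 ((h01.trans h12).trans h') (h12.trans h') h'
  rcases le_or_gt 0 (b 1) with h'' | h''
  · exact sectionVol_aMin_le_of_one_neg hn hs 0 fun j hj => by
      fin_cases j <;> simp at hj ⊢ <;> linarith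
  -- Two negative and three nonnegative entries: negation returns to the 2+3 pattern.
  · rw [← sectionVol_neg b]
    exact sectionVol_aMin_le_of_two_three ((norm_neg b).trans hn) (by simpa using hs)
      (Equiv.ofBijective ![0, 2, 1, 3, 4] (by decide)) (neg_pos.2 h'') (neg_le_neg h01)
      (neg_nonpos.2 h') (neg_nonpos.2 (h'.trans h23)) (neg_nonpos.2 (h'.trans (h23.trans h34)))

theorem theorem3 (n : ℕ) (hn : 1 ≤ n) :
    aMin n ∈ centralNormals n ∧
    ((∀ a : EuclideanSpace ℝ (Fin (n + 1)), ‖a‖ = 1 → ∑ j, a j = 0 →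
        0 ≤ a 0 → (∀ j, j ≠ 0 → a j ≤ 0) → sectionVol (aMin n) ≤ sectionVol a) ∧
      IsLocalMinOn sectionVol (centralNormals n) (aMin n)) ∧
    (n = 2 ∨ n = 3 ∨ n = 4 →
      ∀ a : EuclideanSpace ℝ (Fin (n + 1)), ‖a‖ = 1 → ∑ j, a j = 0 →
        sectionVol (aMin n) ≤ sectionVol a) := by
  obtain ⟨m, rfl⟩ : ∃ m, n = m + 1 := ⟨n - 1, by omega⟩
  refine ⟨aMin_mem_centralNormals m, ⟨fun a ha hs _ hneg => sectionVol_aMin_le_of_head ha hs hneg,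
    isLocalMinOn_aMin m⟩, ?_⟩
  rintro h a ha hs
  have h' : m = 1 ∨ m = 2 ∨ m = 3 := by omega
  rcases h' with rfl | rfl | rfl
  · exact sectionVol_aMin_two_le ha hs
  · exact sectionVol_aMin_three_le ha hs
  · exact sectionVol_aMin_four_le ha hs
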